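/- An MV-algebra is an abelian monoid $(A,\oplus,0)$ with a unary operation $\neg$ such that $\neg\neg x=x$, $x\oplus\neg 0=\neg 0$ and $x\oplus\neg(x\oplus\neg y)=y\oplus\neg(y\oplus\neg x)$; put $1=\neg 0$, $x\odot y=\neg(\neg x\oplus\neg y)$, $x\vee y=\neg(\neg x\oplus y)\oplus y$ and $x\wedge y=\neg(\neg x\vee\neg y)$. The standard MV-algebra is $[0,1]$ with $x\oplus y=\min\{x+y,1\}$ and $\neg x=1-x$. An MV-algebra is simple if its identity congruence is maximal among the proper congruences, and semisimple if it is a subdirect product of simple MV-algebras. The radical of an MV-algebra is the intersection of its maximal congruences. The maximal spectrum of an MV-algebra $A$ is identified with the space $W(A)=\operatorname{Hom}(A,[0,1])$ of MV-homomorphisms, seen as a subspace of the cube $[0,1]^A$ with the product topology. For sets $P\subseteq[0,1]^I$ and $Q\subseteq[0,1]^J$, the product $P\times Q$ is seen as a subset of $[0,1]^{I\uplus J}$. A map $\eta\colon P\to Q$ is a $\mathbb{Z}$-map if for every $j\in J$ there is a map $\xi_j\colon[0,1]^I\to[0,1]$ with $\eta(p)_j=\xi_j(p)$ for all $p\in P$,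 such that $\xi_j$ depends on finitely many coordinates only and, as a function of these, is continuous and piecewise linear with integer coefficients (at each point it agrees with one of finitely many affine functions with integer coefficients). $P$ and $Q$ are $\mathbb{Z}$-homeomorphic if there is a bijective $\mathbb{Z}$-map $P\to Q$ whose inverse is a $\mathbb{Z}$-map. Let $A$ and $B$ be semisimple MV-algebras. Let $A\coprod B$ be their coproduct in the category of MV-algebras. Let $A\otimes B$ be their semisimple tensor product: the quotient by its radical of the MV-algebra with generators $A\times B$ and the relations saying that $(a,b)\mapsto a\otimes b$ is a bimorphism, that is, $1\otimes 1=1$, $a\otimes 0=0=0\otimes b$ and, in each of the two arguments (here written for the second), $a\otimes(b_1\vee b_2)=(a\otimes b_1)\vee(a\otimes b_2)$, $a\otimes(b_1\wedge b_2)=(a\otimes b_1)\wedge(a\otimes b_2)$ and, whenever $b_1\odot b_2=0$, $(a\otimes b_1)\odot(a\otimes b_2)=0$ and $a\otimes(b_1\oplus b_2)=(a\otimes b_1)\oplus(a\otimes b_2)$. Then: 1. $W(A\coprod B)\subseteq[0,1]^{A\coprod B}$ is $\mathbb{Z}$-homeomorphic to $W(A)\times W(B)\subseteq[0,1]^{A\uplus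 B}$. 2. $W(A\coprod B)$ is homeomorphic to $W(A\otimes B)$. Both statements also hold if $A\coprod B$ is replaced by its quotient by the radical, which is the coproduct of $A$ and $B$ in the category of semisimple MV-algebras. -/

import Mathlib

universe u v w

/-- An MV-algebra: an abelian monoid `(A, ⊕, 0)` with an operation `¬` such that
`¬¬x = x`, `x ⊕ ¬0 = ¬0` and `x ⊕ ¬(x ⊕ ¬y) = y ⊕ ¬(y ⊕ ¬x)`. -/
class MVAlgebra (A : Type u) where
  oplus : A → A → A
  zero : A
  neg : A → A
  oplus_assoc : ∀ x y z, oplus (oplus x y) z = oplus x (oplus y z)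
  oplus_comm : ∀ x y, oplus x y = oplus y x
  oplus_zero : ∀ x, oplus x zero = x
  neg_neg : ∀ x, neg (neg x) = x
  oplus_neg_zero : ∀ x, oplus x (neg zero) = neg zero
  lukasiewicz : ∀ x y,
    oplus x (neg (oplus x (neg y))) = oplus y (neg (oplus y (neg x)))

namespace MVAlgebra

/-- Truncated sum `x ⊕ y`. -/
infixl:65 " ⊕ₘ " => MVAlgebra.oplus

/-- Negation `¬ x`. -/
prefix:max "∼" => MVAlgebra.neg

section Operations

variable {A : Type u} [MVAlgebra A]

/-- The top element `1 = ¬0`. -/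
def one : A := ∼(zero : A)

/-- `x ⊙ y = ¬(¬x ⊕ ¬y)`. -/
def odot (x y : A) : A := ∼(∼x ⊕ₘ ∼y)

/-- `x ∨ y = ¬(¬x ⊕ y) ⊕ y`. -/
def sup (x y : A) : A := ∼(∼x ⊕ₘ y) ⊕ₘ y

/-- `x ∧ y = ¬(¬x ∨ ¬y)`. -/
def inf (x y : A) : A := ∼(sup (∼x) (∼y))

end Operations

/-- The standard MV-algebra on `[0,1]`: `x ⊕ y = min (x + y) 1`, `¬x = 1 - x`. -/
noncomputable instance instUnitInterval : MVAlgebra unitInterval where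
  oplus x y := ⟨min ((x : ℝ) + y) 1,
    le_min (add_nonneg x.2.1 y.2.1) zero_le_one, min_le_right _ _⟩
  zero := ⟨0, le_refl 0, zero_le_one⟩
  neg x := ⟨1 - (x : ℝ), sub_nonneg.2 x.2.2, sub_le_self _ x.2.1⟩
  oplus_assoc x y z := by
    apply Subtype.ext
    have hx := x.2.1
    have hz := z.2.1
    change min (min ((x : ℝ) + y) 1 + z) 1 = min ((x : ℝ) + min ((y : ℝ) + z) 1) 1
    rw [← min_add_add_right, ← min_add_add_left, min_assoc, min_assoc, add_assoc,
      min_eq_right (by linarith : (1 : ℝ) ≤ 1 + z), min_eq_right (by linarith : (1 : ℝ) ≤ x + 1)]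
  oplus_comm x y := by
    apply Subtype.ext
    change min ((x : ℝ) + y) 1 = min ((y : ℝ) + x) 1
    rw [add_comm]
  oplus_zero x := by
    apply Subtype.ext
    change min ((x : ℝ) + 0) 1 = x
    rw [add_zero, min_eq_left x.2.2]
  neg_neg x := by
    apply Subtype.ext
    change 1 - (1 - (x : ℝ)) = x
    ring
  oplus_neg_zero x := by
    apply Subtype.ext
    have hx := x.2.1
    change min ((x : ℝ) + (1 - 0)) 1 = 1 - 0
    rw [sub_zero, min_eq_right (by linarith)]
  lukasiewicz x y := by
    apply Subtype.ext
    have hx := x.2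
    have hy := y.2
    change min ((x : ℝ) + (1 - min ((x : ℝ) + (1 - y)) 1)) 1 =
      min ((y : ℝ) + (1 - min ((y : ℝ) + (1 - x)) 1)) 1
    rcases le_total (x : ℝ) y with h | h
    · rw [min_eq_left (by linarith : (x : ℝ) + (1 - y) ≤ 1),
        min_eq_right (by linarith : (1 : ℝ) ≤ y + (1 - x))]
      ring_nf
    · rw [min_eq_right (by linarith : (1 : ℝ) ≤ x + (1 - y)),
        min_eq_left (by linarith : (y : ℝ) + (1 - x) ≤ 1)]
      ring_nf

/-- MV-homomorphisms. -/
structure IsHom {A : Type u} {B : Type v} [MVAlgebra A] [MVAlgebra B] (f : A → B) : Prop where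
  map_zero : f zero = zero
  map_oplus : ∀ x y, f (x ⊕ₘ y) = f x ⊕ₘ f y
  map_neg : ∀ x, f (∼x) = ∼(f x)

/-! ### Congruences, simple and semisimple MV-algebras -/

/-- Congruences of an MV-algebra. -/
structure Cong (A : Type u) [MVAlgebra A] extends Setoid A where
  oplus_congr : ∀ {x x' y y' : A}, r x x' → r y y' → r (x ⊕ₘ y) (x' ⊕ₘ y')
  neg_congr : ∀ {x x' : A}, r x x' → r (∼x) (∼x')

namespace Cong

variable {A : Type u} [MVAlgebra A]

/-- The underlying set of `A / θ`. -/
def Quo (θ : Cong A) : Type u := Quotient θ.toSetoid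

/-- The canonical map `A → A / θ`. -/
def toQuo (θ : Cong A) (a : A) : θ.Quo := Quotient.mk θ.toSetoid a

/-- The quotient MV-algebra `A / θ`. -/
instance (θ : Cong A) : MVAlgebra θ.Quo where
  oplus := Quotient.map₂ (· ⊕ₘ ·) (fun _ _ h _ _ h' => θ.oplus_congr h h')
  zero := θ.toQuo zero
  neg := Quotient.map (fun x => ∼x) (fun _ _ h => θ.neg_congr h)
  oplus_assoc := by
    rintro ⟨x⟩ ⟨y⟩ ⟨z⟩
    exact congrArg θ.toQuo (MVAlgebra.oplus_assoc x y z)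
  oplus_comm := by
    rintro ⟨x⟩ ⟨y⟩
    exact congrArg θ.toQuo (MVAlgebra.oplus_comm x y)
  oplus_zero := by
    rintro ⟨x⟩
    exact congrArg θ.toQuo (MVAlgebra.oplus_zero x)
  neg_neg := by
    rintro ⟨x⟩
    exact congrArg θ.toQuo (MVAlgebra.neg_neg x)
  oplus_neg_zero := by
    rintro ⟨x⟩
    exact congrArg θ.toQuo (MVAlgebra.oplus_neg_zero x)
  lukasiewicz := by
    rintro ⟨x⟩ ⟨y⟩
    exact congrArg θ.toQuo (MVAlgebra.lukasiewicz x y)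

/-- The identity congruence. -/
def identity (A : Type u) [MVAlgebra A] : Cong A where
  r x y := x = y
  iseqv := eq_equivalence
  oplus_congr h h' := by rw [h, h']
  neg_congr h := by rw [h]

/-- A congruence is proper if it does not identify all elements. -/
def IsProper (θ : Cong A) : Prop := ∃ x y : A, ¬ θ.r x y

/-- Maximal elements of the poset of proper congruences. -/
def IsMaximal (θ : Cong A) : Prop :=
  θ.IsProper ∧ ∀ ψ : Cong A, ψ.IsProper → (∀ x y, θ.r x y → ψ.r x y) →
    ∀ x y, ψ.r x y → θ.r x y

/-- The intersection of a set of congruences. -/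
def inter (S : Set (Cong A)) : Cong A where
  r x y := ∀ θ ∈ S, θ.r x y
  iseqv := ⟨fun x θ _ => θ.iseqv.refl x, fun h θ hθ => θ.iseqv.symm (h θ hθ),
    fun h h' θ hθ => θ.iseqv.trans (h θ hθ) (h' θ hθ)⟩
  oplus_congr h h' θ hθ := θ.oplus_congr (h θ hθ) (h' θ hθ)
  neg_congr h θ hθ := θ.neg_congr (h θ hθ)

/-- The congruence generated by a relation. -/
def generated (R : A → A → Prop) : Cong A := inter {θ | ∀ x y, R x y → θ.r x y}

/-- The radical congruence: the intersection of all maximal congruences. -/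
def radical (A : Type u) [MVAlgebra A] : Cong A := inter {θ | θ.IsMaximal}

end Cong

/-- An MV-algebra is simple if its identity congruence is maximal. -/
def IsSimple (A : Type u) [MVAlgebra A] : Prop := (Cong.identity A).IsMaximal

/-- An MV-algebra is semisimple if it is a subdirect product of simple MV-algebras: it has a
family of surjective homomorphisms onto simple MV-algebras that is jointly injective. -/
def IsSemisimple (A : Type u) [MVAlgebra A] : Prop :=
  ∃ (ι : Type u) (S : ι → Type u) (_ : ∀ i, MVAlgebra (S i)) (f : ∀ i, A → S i),
    (∀ i, IsSimple (S i)) ∧ (∀ i, IsHom (f i)) ∧ (∀ i, Function.Surjective (f i)) ∧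
      Function.Injective (fun (a : A) (i : ι) => f i a)

/-- The largest semisimple quotient of `A`, namely `A` modulo its radical. -/
abbrev SemisimpleQuotient (A : Type u) [MVAlgebra A] : Type u := (Cong.radical A).Quo

/-! ### Free MV-algebras, coproducts and tensor products -/

/-- Terms in the language of MV-algebras with variables in `X`. -/
inductive Term (X : Type u) : Type u
  | var : X → Term X
  | zero : Term X
  | oplus : Term X → Term X → Term X
  | neg : Term X → Term X

/-- Equality of terms that is provable from the axioms of MV-algebras. -/
inductive Term.Eqv {X : Type u} : Term X → Term X → Prop
  | refl (s) : Eqv s s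
  | symm {s t} : Eqv s t → Eqv t s
  | trans {s t r} : Eqv s t → Eqv t r → Eqv s r
  | oplus_congr {s s' t t'} : Eqv s s' → Eqv t t' → Eqv (.oplus s t) (.oplus s' t')
  | neg_congr {s s'} : Eqv s s' → Eqv (.neg s) (.neg s')
  | oplus_assoc (s t r) : Eqv (.oplus (.oplus s t) r) (.oplus s (.oplus t r))
  | oplus_comm (s t) : Eqv (.oplus s t) (.oplus t s)
  | oplus_zero (s) : Eqv (.oplus s .zero) s
  | neg_neg (s) : Eqv (.neg (.neg s)) s
  | oplus_neg_zero (s) : Eqv (.oplus s (.neg .zero)) (.neg .zero)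
  | lukasiewicz (s t) : Eqv (.oplus s (.neg (.oplus s (.neg t))))
      (.oplus t (.neg (.oplus t (.neg s))))

/-- Provable equality, as a setoid. -/
def Term.setoid (X : Type u) : Setoid (Term X) :=
  ⟨Term.Eqv, Term.Eqv.refl, Term.Eqv.symm, Term.Eqv.trans⟩

/-- The free MV-algebra over `X`. -/
def Free (X : Type u) : Type u := Quotient (Term.setoid X)

namespace Free

/-- The free generators. -/
def of {X : Type u} (x : X) : Free X := Quotient.mk (Term.setoid X) (.var x)

instance (X : Type u) : MVAlgebra (Free X) where
  oplus := Quotient.map₂ Term.oplus (fun _ _ h _ _ h' => Term.Eqv.oplus_congr h h')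
  zero := Quotient.mk (Term.setoid X) .zero
  neg := Quotient.map Term.neg (fun _ _ h => Term.Eqv.neg_congr h)
  oplus_assoc := by
    rintro ⟨x⟩ ⟨y⟩ ⟨z⟩
    exact Quotient.sound (Term.Eqv.oplus_assoc x y z)
  oplus_comm := by
    rintro ⟨x⟩ ⟨y⟩
    exact Quotient.sound (Term.Eqv.oplus_comm x y)
  oplus_zero := by
    rintro ⟨x⟩
    exact Quotient.sound (Term.Eqv.oplus_zero x)
  neg_neg := by
    rintro ⟨x⟩
    exact Quotient.sound (Term.Eqv.neg_neg x)
  oplus_neg_zero := by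
    rintro ⟨x⟩
    exact Quotient.sound (Term.Eqv.oplus_neg_zero x)
  lukasiewicz := by
    rintro ⟨x⟩ ⟨y⟩
    exact Quotient.sound (Term.Eqv.lukasiewicz x y)

/-- The homomorphism on the free MV-algebra that extends a map of generators, on terms. -/
def termValue {X : Type u} {D : Type v} [MVAlgebra D] (f : X → D) : Term X → D
  | .var x => f x
  | .zero => zero
  | .oplus s t => termValue f s ⊕ₘ termValue f t
  | .neg s => ∼(termValue f s)

/-- The homomorphism on the free MV-algebra that extends a map of generators. -/
def lift {X : Type u} {D : Type v} [MVAlgebra D] (f : X → D) : Free X → D :=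
  Quotient.lift (termValue f) (by
    intro s t h
    induction h with
    | refl => rfl
    | symm _ ih => exact ih.symm
    | trans _ _ ih₁ ih₂ => exact ih₁.trans ih₂
    | oplus_congr _ _ ih₁ ih₂ => simp only [termValue, ih₁, ih₂]
    | neg_congr _ ih => simp only [termValue, ih]
    | oplus_assoc => exact MVAlgebra.oplus_assoc _ _ _
    | oplus_comm => exact MVAlgebra.oplus_comm _ _
    | oplus_zero => exact MVAlgebra.oplus_zero _
    | neg_neg => exact MVAlgebra.neg_neg _
    | oplus_neg_zero => exact MVAlgebra.oplus_neg_zero _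
    | lukasiewicz => exact MVAlgebra.lukasiewicz _ _)

theorem isHom_lift {X : Type u} {D : Type v} [MVAlgebra D] (f : X → D) : IsHom (lift f) where
  map_zero := rfl
  map_oplus := by
    rintro ⟨s⟩ ⟨t⟩
    rfl
  map_neg := by
    rintro ⟨s⟩
    rfl

theorem lift_of {X : Type u} {D : Type v} [MVAlgebra D] (f : X → D) (x : X) :
    lift f (of x) = f x := rfl

theorem hom_ext {X : Type u} {D : Type v} [MVAlgebra D] {g h : Free X → D} (hg : IsHom g)
    (hh : IsHom h) (H : ∀ x, g (of x) = h (of x)) : g = h := by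
  funext z
  obtain ⟨s⟩ := z
  change g (Quotient.mk (Term.setoid X) s) = h (Quotient.mk (Term.setoid X) s)
  induction s with
  | var x => exact H x
  | zero => exact hg.map_zero.trans hh.map_zero.symm
  | oplus s t ihs iht =>
    exact ((hg.map_oplus (Quotient.mk (Term.setoid X) s) (Quotient.mk (Term.setoid X) t)).trans
      (congrArg₂ _ ihs iht)).trans
      (hh.map_oplus (Quotient.mk (Term.setoid X) s) (Quotient.mk (Term.setoid X) t)).symm
  | neg s ih =>
    exact ((hg.map_neg (Quotient.mk (Term.setoid X) s)).trans (congrArg _ ih)).trans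
      (hh.map_neg (Quotient.mk (Term.setoid X) s)).symm

end Free

/-- The universal property of the MV-algebra with generators `X` and defining relations `R`. -/
theorem generated_existsUnique {X : Type u} {D : Type v} [MVAlgebra D]
    (R : Free X → Free X → Prop) (f : X → D) (hf : ∀ s t, R s t → Free.lift f s = Free.lift f t) :
    ∃! h : (Cong.generated R).Quo → D, IsHom h ∧
      ∀ x, h ((Cong.generated R).toQuo (.of x)) = f x := by
  have hl := Free.isHom_lift f
  let θ : Cong (Free X) :=
    { r := fun s t => Free.lift f s = Free.lift f t
      iseqv := ⟨fun _ => rfl, fun h => h.symm, fun h h' => h.trans h'⟩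
      oplus_congr := fun h h' => by rw [hl.map_oplus, hl.map_oplus, h, h']
      neg_congr := fun h => by rw [hl.map_neg, hl.map_neg, h] }
  refine ⟨Quotient.lift (Free.lift f) (fun s t h => h θ hf), ⟨⟨hl.map_zero, ?_, ?_⟩,
    fun x => rfl⟩, ?_⟩
  · rintro ⟨s⟩ ⟨t⟩
    exact hl.map_oplus s t
  · rintro ⟨s⟩
    exact hl.map_neg s
  · rintro g ⟨hg, hgx⟩
    have H : (fun s => g ((Cong.generated R).toQuo s)) = Free.lift f := by
      refine Free.hom_ext ⟨hg.map_zero, fun s t => ?_, fun s => ?_⟩ hl hgx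
      · exact hg.map_oplus ((Cong.generated R).toQuo s) ((Cong.generated R).toQuo t)
      · exact hg.map_neg ((Cong.generated R).toQuo s)
    funext z
    obtain ⟨s⟩ := z
    exact congrFun H s

/-- The defining relations of the coproduct of `A` and `B` in the variety of MV-algebras, on
generators `A ⊎ B`: both inclusions of generators are homomorphisms. -/
inductive CoprodRel (A : Type u) (B : Type v) [MVAlgebra A] [MVAlgebra B] :
    Free (A ⊕ B) → Free (A ⊕ B) → Prop
  | inl_zero : CoprodRel A B (.of (.inl zero)) zero
  | inl_oplus (a a' : A) :
      CoprodRel A B (.of (.inl (a ⊕ₘ a'))) (Free.of (.inl a) ⊕ₘ Free.of (.inl a'))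
  | inl_neg (a : A) : CoprodRel A B (.of (.inl (∼a))) (∼(Free.of (.inl a)))
  | inr_zero : CoprodRel A B (.of (.inr zero)) zero
  | inr_oplus (b b' : B) :
      CoprodRel A B (.of (.inr (b ⊕ₘ b'))) (Free.of (.inr b) ⊕ₘ Free.of (.inr b'))
  | inr_neg (b : B) : CoprodRel A B (.of (.inr (∼b))) (∼(Free.of (.inr b)))

/-- The coproduct of `A` and `B` in the category of MV-algebras. -/
abbrev Coprod (A : Type u) (B : Type v) [MVAlgebra A] [MVAlgebra B] : Type (max u v) :=
  (Cong.generated (CoprodRel A B)).Quo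

/-- The universal property of the coproduct. -/
theorem coprod_existsUnique {A : Type u} {B : Type v} [MVAlgebra A] [MVAlgebra B] :
    IsHom (fun a : A => (Cong.generated (CoprodRel A B)).toQuo (.of (.inl a))) ∧
    IsHom (fun b : B => (Cong.generated (CoprodRel A B)).toQuo (.of (.inr b))) ∧
    ∀ (D : Type w) [MVAlgebra D] (f : A → D) (g : B → D), IsHom f → IsHom g →
      ∃! h : Coprod A B → D, IsHom h ∧
        (∀ a, h ((Cong.generated (CoprodRel A B)).toQuo (.of (.inl a))) = f a) ∧
        (∀ b, h ((Cong.generated (CoprodRel A B)).toQuo (.of (.inr b))) = g b) := by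
  have key : ∀ s t, CoprodRel A B s t →
      (Cong.generated (CoprodRel A B)).toQuo s = (Cong.generated (CoprodRel A B)).toQuo t :=
    fun s t h => Quotient.sound (fun θ hθ => hθ s t h)
  refine ⟨⟨key _ _ .inl_zero, fun a a' => key _ _ (.inl_oplus a a'),
    fun a => key _ _ (.inl_neg a)⟩, ⟨key _ _ .inr_zero, fun b b' => key _ _ (.inr_oplus b b'),
    fun b => key _ _ (.inr_neg b)⟩, fun D _ f g hf hg => ?_⟩
  have H := generated_existsUnique (CoprodRel A B) (Sum.elim f g) (by
    intro s t h
    cases h with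
    | inl_zero => exact hf.map_zero
    | inl_oplus a a' => exact hf.map_oplus a a'
    | inl_neg a => exact hf.map_neg a
    | inr_zero => exact hg.map_zero
    | inr_oplus b b' => exact hg.map_oplus b b'
    | inr_neg b => exact hg.map_neg b)
  simpa only [Sum.forall, Sum.elim_inl, Sum.elim_inr] using H

/-- The defining relations of the tensor product of `A` and `B`, on generators `A × B`: the
map `(a, b) ↦ a ⊗ b` is a bimorphism. -/
inductive TensorRel (A : Type u) (B : Type v) [MVAlgebra A] [MVAlgebra B] :
    Free (A × B) → Free (A × B) → Prop
  | one_one : TensorRel A B (.of (one, one)) one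
  | right_zero (a : A) : TensorRel A B (.of (a, zero)) zero
  | left_zero (b : B) : TensorRel A B (.of (zero, b)) zero
  | right_sup (a : A) (b₁ b₂ : B) :
      TensorRel A B (.of (a, sup b₁ b₂)) (sup (.of (a, b₁)) (.of (a, b₂)))
  | left_sup (a₁ a₂ : A) (b : B) :
      TensorRel A B (.of (sup a₁ a₂, b)) (sup (.of (a₁, b)) (.of (a₂, b)))
  | right_inf (a : A) (b₁ b₂ : B) :
      TensorRel A B (.of (a, inf b₁ b₂)) (inf (.of (a, b₁)) (.of (a, b₂)))
  | left_inf (a₁ a₂ : A) (b : B) :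
      TensorRel A B (.of (inf a₁ a₂, b)) (inf (.of (a₁, b)) (.of (a₂, b)))
  | right_odot (a : A) (b₁ b₂ : B) (h : odot b₁ b₂ = zero) :
      TensorRel A B (odot (.of (a, b₁)) (.of (a, b₂))) zero
  | left_odot (a₁ a₂ : A) (b : B) (h : odot a₁ a₂ = zero) :
      TensorRel A B (odot (.of (a₁, b)) (.of (a₂, b))) zero
  | right_oplus (a : A) (b₁ b₂ : B) (h : odot b₁ b₂ = zero) :
      TensorRel A B (.of (a, b₁ ⊕ₘ b₂)) (Free.of (a, b₁) ⊕ₘ Free.of (a, b₂))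
  | left_oplus (a₁ a₂ : A) (b : B) (h : odot a₁ a₂ = zero) :
      TensorRel A B (.of (a₁ ⊕ₘ a₂, b)) (Free.of (a₁, b) ⊕ₘ Free.of (a₂, b))

/-- The MV-tensor product of `A` and `B`, universal for bimorphisms into MV-algebras. -/
abbrev Tensor (A : Type u) (B : Type v) [MVAlgebra A] [MVAlgebra B] : Type (max u v) :=
  (Cong.generated (TensorRel A B)).Quo

/-- The semisimple tensor product of `A` and `B`: the MV-tensor product modulo its radical. -/
abbrev SemisimpleTensor (A : Type u) (B : Type v) [MVAlgebra A] [MVAlgebra B] :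
    Type (max u v) :=
  SemisimpleQuotient (Tensor A B)

/-! ### Maximal spectra and `ℤ`-maps -/

/-- The maximal spectrum `W(A) = Hom(A, [0,1])`, as a subset of the Tychonoff cube `[0,1]^A`. -/
def W (A : Type u) [MVAlgebra A] : Set (A → unitInterval) := {f | IsHom f}

/-- The product of `P ⊆ [0,1]^I` and `Q ⊆ [0,1]^J`, as a subset of `[0,1]^(I ⊎ J)`. -/
def cubeProd {I : Type u} {J : Type v} (P : Set (I → unitInterval))
    (Q : Set (J → unitInterval)) : Set (I ⊕ J → unitInterval) :=
  {p | (fun i => p (.inl i)) ∈ P ∧ (fun j => p (.inr j)) ∈ Q}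

/-- Continuous piecewise linear maps with integer coefficients on a finite-dimensional cube:
at each point the value agrees with one of finitely many affine maps
`x ↦ c₀ + ∑ i, cᵢ xᵢ` with integers `c₀, cᵢ`. -/
def IsFinIntegerPL {I : Type u} [Fintype I] (f : (I → unitInterval) → unitInterval) : Prop :=
  Continuous f ∧ ∃ F : Finset (ℤ × (I → ℤ)), ∀ x, ∃ c ∈ F,
    (f x : ℝ) = (c.1 : ℝ) + ∑ i, (c.2 i : ℝ) * (x i : ℝ)

/-- Piecewise linear maps with integer coefficients on an arbitrary cube: they factor through
such a map on finitely many coordinates. -/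
def IsIntegerPL {I : Type u} (f : (I → unitInterval) → unitInterval) : Prop :=
  ∃ (s : Finset I) (g : (s → unitInterval) → unitInterval),
    IsFinIntegerPL g ∧ ∀ p, f p = g (fun i => p i)

/-- `ℤ`-maps between subsets of Tychonoff cubes. -/
def IsZMap {I : Type u} {J : Type v} {P : Set (I → unitInterval)} {Q : Set (J → unitInterval)}
    (η : P → Q) : Prop :=
  ∀ j : J, ∃ ξ : (I → unitInterval) → unitInterval,
    IsIntegerPL ξ ∧ ∀ p : P, (η p : J → unitInterval) j = ξ p

/-- `P` and `Q` are `ℤ`-homeomorphic: there is a bijective `ℤ`-map `P → Q` whose inverse is also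
a `ℤ`-map. -/
def ZHomeomorphic {I : Type u} {J : Type v} (P : Set (I → unitInterval))
    (Q : Set (J → unitInterval)) : Prop :=
  ∃ e : P ≃ Q, IsZMap (P := P) (Q := Q) e ∧ IsZMap (P := Q) (Q := P) e.symm

end MVAlgebra

/-! Everything reduces to homomorphisms into [0,1] from algebras given by generators and relations.
Such a homomorphism is determined by its values on the generators, and the admissible values are the
solutions of the relations in [0,1]. Passing between spectrum and solution set is a
`ℤ`-homeomorphism: one direction reads coordinates, and the other evaluates terms, which are
integral piecewise linear (`zHomeomorphic_of_surjective`). Dividing by the radical changes nothing,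
since kernels of homomorphisms into [0,1] are maximal congruences (`Cong.isMaximal_ker`).

For the coproduct the solutions form W(A) × W(B), which gives the first statement. For the tensor
product they are the bimorphisms into [0,1], and the heart of the second statement is that each one
is p(a,b) = f(a)g(b) for a unique pair of homomorphisms f, g (`bimorphism_eq_mul`). This rests on
the Archimedean argument of `IsPartiallyAdditive.eq_mul_of_le`: for fixed a, the map p(a,·) is
additive and lies below the homomorphism p(1,·), so it is a scalar multiple of it. Multiplication of
reals is continuous but not piecewise linear, so the correspondence obtained here is a homeomorphism
only. -/

namespace MVAlgebra

/-! ### Elementary identities -/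

section Identities

variable {A : Type u} [MVAlgebra A]

theorem oplus_neg_self (x : A) : x ⊕ₘ ∼x = (one : A) := by
  have h := lukasiewicz x (∼(zero : A))
  rw [neg_neg, oplus_zero, oplus_comm (∼(zero : A)) (∼x), oplus_neg_zero,
    oplus_comm (∼(zero : A)), oplus_neg_zero] at h
  exact h

theorem neg_one : ∼(one : A) = zero := neg_neg _

theorem oplus_one (x : A) : x ⊕ₘ one = one := oplus_neg_zero x

theorem oplus_left_comm (x y z : A) : x ⊕ₘ (y ⊕ₘ z) = y ⊕ₘ (x ⊕ₘ z) := by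
  rw [← oplus_assoc, oplus_comm x y, oplus_assoc]

theorem odot_neg_self (x : A) : odot x (∼x) = zero := by
  rw [odot, oplus_neg_self, neg_one]

theorem inf_neg_eq_neg_oplus_odot (x y : A) : inf (∼x) y = ∼(∼y ⊕ₘ odot x y) := by
  rw [inf, sup, neg_neg, oplus_comm, odot]

/-- The meet `¬x ∧ y` is the difference of `x ⊕ y` and `x`. -/
theorem inf_neg_eq_neg_oplus_neg (x y : A) : inf (∼x) y = ∼(x ⊕ₘ ∼(x ⊕ₘ y)) := by
  rw [inf_neg_eq_neg_oplus_odot, odot, oplus_comm (∼x), lukasiewicz (∼y) x, neg_neg]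

/-- The element ¬x ∧ y is the part of y that still fits on top of x. Together with `odot_inf_neg`
this turns an arbitrary sum into one with zero product, where partial additivity applies. -/
theorem oplus_inf_neg (x y : A) : x ⊕ₘ inf (∼x) y = x ⊕ₘ y := by
  rw [inf_neg_eq_neg_oplus_neg, lukasiewicz, oplus_comm (x ⊕ₘ y) (∼x), oplus_left_comm,
    ← oplus_assoc, oplus_neg_self, oplus_comm one, oplus_one, neg_one, oplus_zero]

theorem odot_inf_neg (x y : A) : odot x (inf (∼x) y) = zero := by
  rw [inf_neg_eq_neg_oplus_neg, odot, neg_neg, oplus_left_comm, ← oplus_assoc,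
    oplus_neg_self, oplus_comm, oplus_one, neg_one]

/-- Splits y into the part that fits on top of x and the overflow x ⊙ y; by `odot_inf_neg_odot` the
two parts have zero product. -/
theorem inf_neg_oplus_odot (x y : A) : inf (∼x) y ⊕ₘ odot x y = y := by
  rw [inf_neg_eq_neg_oplus_odot, oplus_comm, oplus_comm (∼y), lukasiewicz]
  simp only [odot, neg_neg]
  rw [oplus_left_comm, oplus_neg_self, oplus_one, neg_one, oplus_zero]

theorem odot_inf_neg_odot (x y : A) : odot (inf (∼x) y) (odot x y) = zero := by
  rw [inf_neg_eq_neg_oplus_odot]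
  generalize odot x y = w
  rw [odot, neg_neg, oplus_assoc, oplus_neg_self, oplus_one, neg_one]

end Identities

/-! ### Homomorphisms and the standard algebra -/

namespace IsHom

variable {A : Type u} {B : Type v} {C : Type w} [MVAlgebra A] [MVAlgebra B] [MVAlgebra C]
  {f : A → B}

theorem map_one (hf : IsHom f) : f one = one := by
  rw [one, hf.map_neg, hf.map_zero, one]

theorem map_odot (hf : IsHom f) (x y : A) : f (odot x y) = odot (f x) (f y) := by
  simp only [odot, hf.map_neg, hf.map_oplus]

theorem map_sup (hf : IsHom f) (x y : A) : f (sup x y) = sup (f x) (f y) := by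
  simp only [sup, hf.map_neg, hf.map_oplus]

theorem map_inf (hf : IsHom f) (x y : A) : f (inf x y) = inf (f x) (f y) := by
  simp only [inf, hf.map_neg, hf.map_sup]

theorem comp {g : B → C} (hg : IsHom g) (hf : IsHom f) : IsHom (fun a => g (f a)) where
  map_zero := by rw [hf.map_zero, hg.map_zero]
  map_oplus x y := by rw [hf.map_oplus, hg.map_oplus]
  map_neg x := by rw [hf.map_neg, hg.map_neg]

end IsHom

theorem Cong.isHom_toQuo {A : Type u} [MVAlgebra A] (θ : Cong A) : IsHom θ.toQuo :=
  ⟨rfl, fun _ _ => rfl, fun _ => rfl⟩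

theorem Cong.toQuo_surjective {A : Type u} [MVAlgebra A] (θ : Cong A) :
    Function.Surjective θ.toQuo := by
  rintro ⟨a⟩
  exact ⟨a, rfl⟩

section Standard

variable (x y : unitInterval)

theorem coe_zero : ((zero : unitInterval) : ℝ) = 0 := rfl

theorem coe_oplus : ((x ⊕ₘ y : unitInterval) : ℝ) = min ((x : ℝ) + y) 1 := rfl

theorem coe_neg : ((∼x : unitInterval) : ℝ) = 1 - x := rfl

theorem coe_one : ((one : unitInterval) : ℝ) = 1 := sub_zero 1

theorem coe_odot : ((odot x y : unitInterval) : ℝ) = max ((x : ℝ) + y - 1) 0 := by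
  rw [odot, coe_neg, coe_oplus, coe_neg, coe_neg]
  rcases le_total ((x : ℝ) + y) 1 with h | h
  · rw [min_eq_right (by linarith), max_eq_right (by linarith)]; ring
  · rw [min_eq_left (by linarith), max_eq_left (by linarith)]; ring

theorem coe_sup : ((sup x y : unitInterval) : ℝ) = max (x : ℝ) y := by
  have hx := x.2
  have hy := y.2
  rw [sup, coe_oplus, coe_neg, coe_oplus, coe_neg]
  rcases le_total (x : ℝ) y with h | h
  · rw [max_eq_right h, min_eq_right (by linarith : (1 : ℝ) ≤ 1 - x + y),
      min_eq_left (by linarith [hy.2])]; ring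
  · rw [max_eq_left h, min_eq_left (by linarith : 1 - (x : ℝ) + y ≤ 1),
      min_eq_left (by linarith [hx.2])]; ring

theorem coe_inf : ((inf x y : unitInterval) : ℝ) = min (x : ℝ) y := by
  rw [inf, coe_neg, coe_sup, coe_neg, coe_neg]
  rcases le_total (x : ℝ) y with h | h
  · rw [min_eq_left h, max_eq_left (by linarith)]; ring
  · rw [min_eq_right h, max_eq_right (by linarith)]; ring

variable {x y}

theorem odot_eq_zero_iff : odot x y = zero ↔ (x : ℝ) + y ≤ 1 := by
  rw [← Subtype.coe_inj, coe_odot, coe_zero, max_eq_right_iff, sub_nonpos]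

theorem coe_oplus_of_odot_eq_zero (h : odot x y = zero) :
    ((x ⊕ₘ y : unitInterval) : ℝ) = x + y := by
  rw [coe_oplus, min_eq_left (odot_eq_zero_iff.1 h)]

end Standard

/-! ### Homomorphisms into the standard algebra factor through the radical -/

section Radical

variable {A : Type u} [MVAlgebra A]

/-- The kernel of a homomorphism. -/
def Cong.ker {B : Type v} [MVAlgebra B] {f : A → B} (hf : IsHom f) : Cong A where
  r x y := f x = f y
  iseqv := ⟨fun _ => rfl, fun h => h.symm, fun h h' => h.trans h'⟩
  oplus_congr h h' := by rw [hf.map_oplus, hf.map_oplus, h, h']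
  neg_congr h := by rw [hf.map_neg, hf.map_neg, h]

/-- The `n`-fold truncated sum of an element. -/
def nsum (x : A) : ℕ → A
  | 0 => zero
  | n + 1 => nsum x n ⊕ₘ x

theorem coe_map_nsum {f : A → unitInterval} (hf : IsHom f) (x : A) (n : ℕ) :
    (f (nsum x n) : ℝ) = min (n * (f x : ℝ)) 1 := by
  induction n with
  | zero => simp [nsum, hf.map_zero, coe_zero]
  | succ n ih =>
    have hx := (f x).2.1
    rw [nsum, hf.map_oplus, coe_oplus, ih, ← min_add_add_right, min_assoc,
      min_eq_right (by linarith : (1 : ℝ) ≤ 1 + f x)]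
    push_cast
    ring_nf

/-- This is the Archimedean property of [0,1]. If ψ contains the kernel and identifies x, y with f y
< f x, then d = x ⊙ ¬y is ψ-related to 0 and f d > 0. Some multiple of d has f-value 1, so ψ
identifies 0 with 1 and is not proper. -/
theorem Cong.isMaximal_ker {f : A → unitInterval} (hf : IsHom f) : (Cong.ker hf).IsMaximal := by
  refine ⟨⟨zero, one, fun h => ?_⟩, fun ψ hψ hle => ?_⟩
  · have h' : f zero = f one := h
    rw [hf.map_zero, hf.map_one, ← Subtype.coe_inj, coe_zero, coe_one] at h'
    exact zero_ne_one h'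
  have key : ∀ x y, ψ.r x y → ¬ (f y : ℝ) < f x := by
    intro x y hxy hlt
    set d : A := odot x (∼y) with hd
    have hfd : (f d : ℝ) = f x - f y := by
      rw [hd, hf.map_odot, coe_odot, hf.map_neg, coe_neg, max_eq_left (by linarith)]
      ring
    have hd0 : ψ.r d zero := by
      rw [← odot_neg_self y]
      exact ψ.neg_congr (ψ.oplus_congr (ψ.neg_congr hxy) (ψ.iseqv.refl _))
    have hn0 : ∀ n, ψ.r (nsum d n) zero := by
      intro n
      induction n with
      | zero => exact ψ.iseqv.refl _
      | succ n ih =>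
        have h := ψ.oplus_congr ih hd0
        rwa [oplus_zero] at h
    obtain ⟨n, hn⟩ := exists_nat_gt (1 / (f d : ℝ))
    have hpos : 0 < (f d : ℝ) := by rw [hfd]; linarith
    rw [div_lt_iff₀ hpos] at hn
    -- Both sides have f-value 1, so the kernel, and hence ψ, relates them.
    have h1 : ψ.r (nsum d n) one := by
      refine hle _ _ (Subtype.ext ?_)
      rw [coe_map_nsum hf, min_eq_right hn.le, hf.map_one, coe_one]
    have h01 : ψ.r one zero := ψ.iseqv.trans (ψ.iseqv.symm h1) (hn0 n)
    obtain ⟨a, b, hab⟩ := hψ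
    have h0 : ∀ a, ψ.r a one := by
      intro a
      have h := ψ.oplus_congr (ψ.iseqv.refl a) h01
      rw [oplus_one, oplus_zero] at h
      exact ψ.iseqv.symm h
    exact hab (ψ.iseqv.trans (h0 a) (ψ.iseqv.symm (h0 b)))
  exact fun x y hxy => Subtype.ext
    (le_antisymm (not_lt.1 (key x y hxy)) (not_lt.1 (key y x (ψ.iseqv.symm hxy))))

/-- Homomorphisms into `[0,1]` factor through the radical quotient. -/
theorem exists_hom_semisimpleQuotient {f : A → unitInterval} (hf : IsHom f) :
    ∃ g : SemisimpleQuotient A → unitInterval, IsHom g ∧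
      ∀ a, g ((Cong.radical A).toQuo a) = f a := by
  refine ⟨Quotient.lift f fun x y h => h _ (Cong.isMaximal_ker hf),
    ⟨hf.map_zero, ?_, ?_⟩, fun _ => rfl⟩
  · rintro ⟨x⟩ ⟨y⟩
    exact hf.map_oplus x y
  · rintro ⟨x⟩
    exact hf.map_neg x

end Radical

/-! ### Terms are `ℤ`-maps -/

section Terms

variable {X : Type u}

theorem IsFinIntegerPL.const_zero [Fintype X] :
    IsFinIntegerPL (fun _ : X → unitInterval => (zero : unitInterval)) :=
  ⟨continuous_const, {(0, 0)}, fun x => ⟨_, Finset.mem_singleton_self _, by simp [coe_zero]⟩⟩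

theorem IsFinIntegerPL.eval [Fintype X] (i : X) :
    IsFinIntegerPL (fun x : X → unitInterval => x i) := by
  classical
  exact ⟨continuous_apply i, {(0, Pi.single i 1)},
    fun x => ⟨_, Finset.mem_singleton_self _, by simp [Pi.single_apply]⟩⟩

theorem IsFinIntegerPL.neg [Fintype X] {f : (X → unitInterval) → unitInterval}
    (hf : IsFinIntegerPL f) : IsFinIntegerPL (fun x => ∼(f x)) := by
  classical
  obtain ⟨hc, F, hF⟩ := hf
  refine ⟨?_, F.image fun c => (1 - c.1, fun i => - c.2 i), fun x => ?_⟩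
  · exact (continuous_const.sub (continuous_subtype_val.comp hc)).subtype_mk _
  · obtain ⟨c, hcF, hcx⟩ := hF x
    refine ⟨_, Finset.mem_image_of_mem _ hcF, ?_⟩
    rw [coe_neg, hcx]
    push_cast
    simp only [neg_mul, Finset.sum_neg_distrib]
    ring

theorem IsFinIntegerPL.oplus [Fintype X] {f g : (X → unitInterval) → unitInterval}
    (hf : IsFinIntegerPL f) (hg : IsFinIntegerPL g) : IsFinIntegerPL (fun x => f x ⊕ₘ g x) := by
  classical
  obtain ⟨hc, F, hF⟩ := hf
  obtain ⟨hd, G, hG⟩ := hg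
  -- The constant 1 serves the points where the sum is truncated; elsewhere a sum of pieces of f and
  -- g works.
  refine ⟨?_, insert (1, 0) ((F ×ˢ G).image fun c => (c.1.1 + c.2.1, fun i => c.1.2 i + c.2.2 i)),
    fun x => ?_⟩
  · exact (((continuous_subtype_val.comp hc).add (continuous_subtype_val.comp hd)).min
      continuous_const).subtype_mk _
  · obtain ⟨c, hcF, hcx⟩ := hF x
    obtain ⟨d, hdG, hdx⟩ := hG x
    rw [coe_oplus]
    rcases le_total ((f x : ℝ) + g x) 1 with h | h
    · refine ⟨_, Finset.mem_insert_of_mem (Finset.mem_image_of_mem _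
        (Finset.mk_mem_product hcF hdG)), ?_⟩
      rw [min_eq_left h, hcx, hdx]
      push_cast
      simp only [add_mul, Finset.sum_add_distrib]
      ring
    · refine ⟨_, Finset.mem_insert_self _ _, ?_⟩
      rw [min_eq_right h]
      simp

/-- Extension by zero of a point of the cube over a finite set of coordinates. -/
noncomputable def extendZero (s : Finset X) (y : s → unitInterval) (x : X) : unitInterval :=
  open Classical in if h : x ∈ s then y ⟨x, h⟩ else zero

theorem isFinIntegerPL_termValue (s : Finset X) (t : Term X) :
    IsFinIntegerPL (fun y : s → unitInterval => Free.termValue (extendZero s y) t) := by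
  induction t with
  | var x =>
    by_cases h : x ∈ s
    · simpa only [Free.termValue, extendZero, dif_pos h] using IsFinIntegerPL.eval (⟨x, h⟩ : s)
    · simpa only [Free.termValue, extendZero, dif_neg h] using
        IsFinIntegerPL.const_zero (X := s)
  | zero => exact IsFinIntegerPL.const_zero
  | oplus t t' ih ih' => exact ih.oplus ih'
  | neg t ih => exact ih.neg

/-- A term contains finitely many variables, so the default value zero off s' is never read.
Allowing every s' ⊇ s lets the inductive step for a sum use the union of two supports. -/
theorem exists_termValue_extendZero (t : Term X) :
    ∃ s : Finset X, ∀ s', s ⊆ s' → ∀ p : X → unitInterval,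
      Free.termValue p t = Free.termValue (extendZero s' fun i => p i) t := by
  classical
  induction t with
  | var x =>
    refine ⟨{x}, fun s' h p => ?_⟩
    have hx : x ∈ s' := h (Finset.mem_singleton_self x)
    simp only [Free.termValue, extendZero, dif_pos hx]
  | zero => exact ⟨∅, fun _ _ _ => rfl⟩
  | oplus t t' ih ih' =>
    obtain ⟨s, hs⟩ := ih
    obtain ⟨r, hr⟩ := ih'
    refine ⟨s ∪ r, fun s' h p => ?_⟩
    simp only [Free.termValue]
    rw [hs s' (Finset.union_subset_left h) p, hr s' (Finset.union_subset_right h) p]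
  | neg t ih =>
    obtain ⟨s, hs⟩ := ih
    refine ⟨s, fun s' h p => ?_⟩
    simp only [Free.termValue]
    rw [hs s' h p]

theorem isIntegerPL_lift (z : Free X) :
    IsIntegerPL (fun p : X → unitInterval => Free.lift p z) := by
  obtain ⟨t⟩ := z
  obtain ⟨s, hs⟩ := exists_termValue_extendZero t
  exact ⟨s, _, isFinIntegerPL_termValue s t, hs s subset_rfl⟩

theorem isIntegerPL_eval (x : X) : IsIntegerPL (fun p : X → unitInterval => p x) :=
  isIntegerPL_lift (Free.of x)

theorem IsIntegerPL.continuous {f : (X → unitInterval) → unitInterval} (hf : IsIntegerPL f) :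
    Continuous f := by
  obtain ⟨s, g, hg, h⟩ := hf
  rw [funext h]
  exact hg.1.comp (continuous_pi fun i => continuous_apply _)

theorem IsZMap.continuous {J : Type v} {P : Set (X → unitInterval)}
    {Q : Set (J → unitInterval)} {η : P → Q} (hη : IsZMap η) : Continuous η := by
  refine Continuous.subtype_mk (f := fun p => (η p : J → unitInterval))
    (continuous_pi fun j => ?_) _
  obtain ⟨ξ, hξ, h⟩ := hη j
  rw [funext h]
  exact hξ.continuous.comp continuous_subtype_val

theorem ZHomeomorphic.nonempty_homeomorph {J : Type v} {P : Set (X → unitInterval)}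
    {Q : Set (J → unitInterval)} (h : ZHomeomorphic P Q) : Nonempty (P ≃ₜ Q) := by
  obtain ⟨e, he, he'⟩ := h
  exact ⟨⟨e, he.continuous, he'.continuous⟩⟩

/-- The maximal spectrum of an algebra generated by the image of `X` is `ℤ`-homeomorphic to the
set of all assignments on `X` that extend to a homomorphism into `[0,1]`. -/
theorem zHomeomorphic_of_surjective {D : Type v} [MVAlgebra D] {q : Free X → D} (hq : IsHom q)
    (hs : Function.Surjective q) {V : Set (X → unitInterval)}
    (hV : ∀ p, p ∈ V ↔ ∃ h ∈ W D, ∀ x, h (q (.of x)) = p x) : ZHomeomorphic (W D) V := by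
  have hlift : ∀ {h : D → unitInterval} {p : X → unitInterval}, h ∈ W D →
      (∀ x, h (q (.of x)) = p x) → ∀ z, h (q z) = Free.lift p z := fun {h p} hh hp z =>
    congrFun (Free.hom_ext (IsHom.comp (f := q) hh hq) (Free.isHom_lift p) hp) z
  have hmem : ∀ h : W D, (fun x => (h : D → unitInterval) (q (.of x))) ∈ V :=
    fun h => (hV _).2 ⟨h, h.2, fun _ => rfl⟩
  -- The chosen extension is the only one, because q is surjective and `hlift` fixes its values on
  -- the range of q.
  choose! g hg hgp using fun p => (hV p).1
  refine ⟨⟨fun h => ⟨_, hmem h⟩, fun p => ⟨g p, hg p p.2⟩, fun h => Subtype.ext (funext fun d => ?_),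
    fun p => Subtype.ext (funext fun x => hgp p p.2 x)⟩, fun x => ?_, fun d => ?_⟩
  · obtain ⟨z, rfl⟩ := hs d
    exact (hlift (hg _ (hmem h)) (hgp _ (hmem h)) z).trans (hlift h.2 (fun _ => rfl) z).symm
  · exact ⟨_, isIntegerPL_eval (q (.of x)), fun _ => rfl⟩
  · obtain ⟨z, rfl⟩ := hs d
    exact ⟨_, isIntegerPL_lift z, fun p => hlift (hg p p.2) (hgp p p.2) z⟩

/-- The spectrum of a presented algebra is the set of solutions of the defining relations. -/
theorem zHomeomorphic_generated (R : Free X → Free X → Prop) :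
    ZHomeomorphic (W (Cong.generated R).Quo)
      {p : X → unitInterval | ∀ s t, R s t → Free.lift p s = Free.lift p t} := by
  refine zHomeomorphic_of_surjective (Cong.isHom_toQuo _) (Cong.toQuo_surjective _) fun p => ?_
  refine ⟨fun hp => (generated_existsUnique R p hp).exists, ?_⟩
  rintro ⟨h, hh, hp⟩ s t hst
  have H := Free.hom_ext (IsHom.comp hh (Cong.isHom_toQuo _)) (Free.isHom_lift p) hp
  rw [← H]
  exact congrArg h (Quotient.sound fun θ hθ => hθ s t hst)

/-- The solution set is the same as without the radical, since every homomorphism into [0,1]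
descends to the radical quotient. -/
theorem zHomeomorphic_semisimpleQuotient_generated (R : Free X → Free X → Prop) :
    ZHomeomorphic (W (SemisimpleQuotient (Cong.generated R).Quo))
      {p : X → unitInterval | ∀ s t, R s t → Free.lift p s = Free.lift p t} := by
  refine zHomeomorphic_of_surjective
    (IsHom.comp (Cong.isHom_toQuo (Cong.radical _)) (Cong.isHom_toQuo (Cong.generated R)))
    ((Cong.toQuo_surjective _).comp (Cong.toQuo_surjective _)) fun p => ?_
  constructor
  · intro hp
    obtain ⟨h, hh, hp⟩ := (generated_existsUnique R p hp).exists
    obtain ⟨g, hg, hgh⟩ := exists_hom_semisimpleQuotient hh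
    exact ⟨g, hg, fun x => (hgh _).trans (hp x)⟩
  · rintro ⟨h, hh, hp⟩ s t hst
    have H := Free.hom_ext (IsHom.comp hh (IsHom.comp (Cong.isHom_toQuo (Cong.radical _))
      (Cong.isHom_toQuo (Cong.generated R)))) (Free.isHom_lift p) hp
    rw [← H]
    have hq : (Cong.generated R).toQuo s = (Cong.generated R).toQuo t :=
      Quotient.sound fun θ hθ => hθ s t hst
    simp only [hq]

end Terms

/-! ### Coproducts -/

theorem coprodRel_solutions (A : Type u) (B : Type v) [MVAlgebra A] [MVAlgebra B] :
    {p : A ⊕ B → unitInterval | ∀ s t, CoprodRel A B s t → Free.lift p s = Free.lift p t} =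
      cubeProd (W A) (W B) := by
  ext p
  constructor
  · intro h
    exact ⟨⟨h _ _ .inl_zero, fun a a' => h _ _ (.inl_oplus a a'), fun a => h _ _ (.inl_neg a)⟩,
      ⟨h _ _ .inr_zero, fun a a' => h _ _ (.inr_oplus a a'), fun a => h _ _ (.inr_neg a)⟩⟩
  · rintro ⟨hf, hg⟩ s t h
    cases h with
    | inl_zero => exact hf.map_zero
    | inl_oplus a a' => exact hf.map_oplus a a'
    | inl_neg a => exact hf.map_neg a
    | inr_zero => exact hg.map_zero
    | inr_oplus b b' => exact hg.map_oplus b b'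
    | inr_neg b => exact hg.map_neg b

/-! ### Bimorphisms into the standard algebra -/

section Bimorphisms

variable {A : Type u} {B : Type v} [MVAlgebra A] [MVAlgebra B]

/-- Maps into `[0,1]` that are additive on pairs with zero product. -/
def IsPartiallyAdditive (φ : A → unitInterval) : Prop :=
  ∀ x y, odot x y = zero → (φ (x ⊕ₘ y) : ℝ) = φ x + φ y

theorem IsHom.isPartiallyAdditive {f : A → unitInterval} (hf : IsHom f) :
    IsPartiallyAdditive f := by
  intro x y h
  rw [hf.map_oplus, coe_oplus_of_odot_eq_zero]
  rw [← hf.map_odot, h, hf.map_zero]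

namespace IsPartiallyAdditive

variable {φ g : A → unitInterval}

/-- Apply additivity to x ⊕ y = x ⊕ (¬x ∧ y) and to y = (¬x ∧ y) ⊕ (x ⊙ y), then cancel φ(¬x ∧ y).
-/
theorem map_oplus_add_map_odot (hφ : IsPartiallyAdditive φ) (x y : A) :
    (φ (x ⊕ₘ y) : ℝ) + φ (odot x y) = φ x + φ y := by
  have h₁ := hφ _ _ (odot_inf_neg x y)
  have h₂ := hφ _ _ (odot_inf_neg_odot x y)
  rw [oplus_inf_neg] at h₁
  rw [inf_neg_oplus_odot] at h₂
  linarith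

theorem map_add_map_neg (hφ : IsPartiallyAdditive φ) (x : A) :
    (φ x : ℝ) + φ (∼x) = φ one := by
  rw [← hφ _ _ (odot_neg_self x), oplus_neg_self]

/-- Additivity on x ⊕ (¬x ∧ y) gives φ x + min(1 - φ x, φ y), which is the truncated sum. -/
theorem isHom (hφ : IsPartiallyAdditive φ) (h0 : φ zero = zero) (h1 : φ one = one)
    (hinf : ∀ x y, φ (inf x y) = inf (φ x) (φ y)) : IsHom φ := by
  have hneg : ∀ x, φ (∼x) = ∼(φ x) := by
    intro x
    have h := hφ.map_add_map_neg x
    rw [h1, coe_one] at h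
    exact Subtype.ext (by rw [coe_neg]; linarith)
  refine ⟨h0, fun x y => Subtype.ext ?_, hneg⟩
  rw [← oplus_inf_neg, hφ _ _ (odot_inf_neg x y), hinf, hneg, coe_inf, coe_neg, coe_oplus,
    ← min_add_add_left, min_comm]
  ring_nf

/-- A partially additive map below a homomorphism into `[0,1]` is a multiple of it. -/
theorem eq_mul_of_le (hφ : IsPartiallyAdditive φ) (hg : IsHom g)
    (hle : ∀ x, (φ x : ℝ) ≤ g x) (x : A) : (φ x : ℝ) = φ one * g x := by
  -- Add x repeatedly, with k counting the carries and z holding the remainder. The map φ obeys the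
  -- same bookkeeping, each carry being worth φ 1.
  have step : ∀ n : ℕ, ∃ (k : ℕ) (z : A), (n : ℝ) * g x = k + g z ∧
      (n : ℝ) * φ x = k * φ one + φ z := by
    intro n
    induction n with
    | zero =>
      have h := hle zero
      have h' := (φ zero).2.1
      rw [hg.map_zero, coe_zero] at h
      exact ⟨0, zero, by simp [hg.map_zero, coe_zero], by simpa using le_antisymm h' h⟩
    | succ n ih =>
      obtain ⟨k, z, h₁, h₂⟩ := ih
      have hgz := hg.isPartiallyAdditive.map_oplus_add_map_odot z x
      have hφz := hφ.map_oplus_add_map_odot z x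
      -- Without a carry, g (z ⊙ x) = 0 forces φ (z ⊙ x) = 0. With a carry, g (¬(z ⊕ x)) = 0 forces
      -- φ (z ⊕ x) = φ 1. Both use φ ≤ g.
      rcases le_total ((g z : ℝ) + g x) 1 with h | h
      · have hg0 : (g (odot z x) : ℝ) = 0 := by
          rw [hg.map_odot, odot_eq_zero_iff.2 h, coe_zero]
        have hφ0 : (φ (odot z x) : ℝ) = 0 :=
          le_antisymm (hg0 ▸ hle _) (φ (odot z x)).2.1
        exact ⟨k, z ⊕ₘ x, by push_cast; linarith, by push_cast; linarith⟩
      · have hg1 : (g (z ⊕ₘ x) : ℝ) = 1 := by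
          rw [hg.map_oplus, coe_oplus, min_eq_right h]
        have hn := hle (∼(z ⊕ₘ x))
        rw [hg.map_neg, coe_neg, hg1, sub_self] at hn
        have hφ1 := hφ.map_add_map_neg (z ⊕ₘ x)
        have hn' := le_antisymm hn (φ (∼(z ⊕ₘ x))).2.1
        exact ⟨k + 1, odot z x, by push_cast; linarith, by push_cast; linarith⟩
  -- Eliminating k shows that n times the error at x is the error at z, a difference of two numbers
  -- in [0,1].
  have bound : ∀ n : ℕ, n * |(φ x : ℝ) - φ one * g x| ≤ 1 := by
    intro n
    obtain ⟨k, z, h₁, h₂⟩ := step n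
    have h : (n : ℝ) * ((φ x : ℝ) - φ one * g x) = φ z - φ one * g z := by
      linear_combination h₂ - (φ one : ℝ) * h₁
    rw [← Nat.abs_cast n, ← abs_mul, h, abs_le]
    have hm : (0 : ℝ) ≤ φ one * g z := mul_nonneg (φ one).2.1 (g z).2.1
    have hm' : (φ one : ℝ) * g z ≤ 1 := mul_le_one₀ (φ one).2.2 (g z).2.1 (g z).2.2
    constructor <;> linarith [(φ z).2.1, (φ z).2.2]
  by_contra hne
  have hpos : 0 < |(φ x : ℝ) - φ one * g x| := abs_pos.2 (sub_ne_zero.2 hne)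
  obtain ⟨n, hn⟩ := exists_nat_gt (1 / |(φ x : ℝ) - φ one * g x|)
  rw [div_lt_iff₀ hpos] at hn
  exact absurd (bound n) (not_le.2 hn)

end IsPartiallyAdditive

/-- The set of bimorphisms from `A` and `B` to `[0,1]`. -/
def bimorphisms (A : Type u) (B : Type v) [MVAlgebra A] [MVAlgebra B] :
    Set (A × B → unitInterval) :=
  {p | ∀ s t, TensorRel A B s t → Free.lift p s = Free.lift p t}

theorem isPartiallyAdditive_of_forall {φ : A → unitInterval}
    (h : ∀ x y, odot x y = zero → odot (φ x) (φ y) = zero)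
    (h' : ∀ x y, odot x y = zero → φ (x ⊕ₘ y) = φ x ⊕ₘ φ y) : IsPartiallyAdditive φ :=
  fun x y hxy => by rw [h' x y hxy, coe_oplus_of_odot_eq_zero (h x y hxy)]

section Components

variable {p : A × B → unitInterval}

theorem isPartiallyAdditive_right (hp : p ∈ bimorphisms A B) (a : A) :
    IsPartiallyAdditive fun b => p (a, b) :=
  isPartiallyAdditive_of_forall (fun b b' h => hp _ _ (.right_odot a b b' h))
    (fun b b' h => hp _ _ (.right_oplus a b b' h))

theorem isPartiallyAdditive_left (hp : p ∈ bimorphisms A B) (b : B) :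
    IsPartiallyAdditive fun a => p (a, b) :=
  isPartiallyAdditive_of_forall (fun a a' h => hp _ _ (.left_odot a a' b h))
    (fun a a' h => hp _ _ (.left_oplus a a' b h))

theorem isHom_right (hp : p ∈ bimorphisms A B) : IsHom fun b => p (one, b) :=
  (isPartiallyAdditive_right hp one).isHom (hp _ _ (.right_zero one)) (hp _ _ .one_one)
    fun b b' => (hp _ _ (.right_inf one b b')).trans ((Free.isHom_lift p).map_inf _ _)

theorem isHom_left (hp : p ∈ bimorphisms A B) : IsHom fun a => p (a, one) :=
  (isPartiallyAdditive_left hp one).isHom (hp _ _ (.left_zero one)) (hp _ _ .one_one)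
    fun a a' => (hp _ _ (.left_inf a a' one)).trans ((Free.isHom_lift p).map_inf _ _)

/-- A bimorphism into `[0,1]` is the product of its two components. -/
theorem bimorphism_eq_mul (hp : p ∈ bimorphisms A B) (a : A) (b : B) :
    p (a, b) = p (a, one) * p (one, b) := by
  -- The bound p(a,b) ≤ p(1,b) holds because p(a,b) + p(¬a,b) = p(1,b); the scalar is the value of
  -- p(a,·) at 1.
  refine Subtype.ext ((isPartiallyAdditive_right hp a).eq_mul_of_le (isHom_right hp)
    (fun b => ?_) b)
  have h := (isPartiallyAdditive_left hp b).map_add_map_neg a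
  have h' := (p (∼a, b)).2.1
  change (p (a, b) : ℝ) ≤ p (one, b)
  linarith

end Components

theorem isPartiallyAdditive_const_mul (c : unitInterval) {f : A → unitInterval} (hf : IsHom f) :
    IsPartiallyAdditive fun a => c * f a := by
  intro x y h
  change (c : ℝ) * f (x ⊕ₘ y) = c * f x + c * f y
  rw [hf.isPartiallyAdditive x y h, mul_add]

theorem mul_sup_eq (c x y : unitInterval) : c * sup x y = sup (c * x) (c * y) := by
  apply Subtype.ext
  rw [coe_sup]
  change (c : ℝ) * (sup x y : unitInterval) = max ((c : ℝ) * x) (c * y)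
  rw [coe_sup, mul_max_of_nonneg _ _ c.2.1]

theorem mul_inf_eq (c x y : unitInterval) : c * inf x y = inf (c * x) (c * y) := by
  apply Subtype.ext
  rw [coe_inf]
  change (c : ℝ) * (inf x y : unitInterval) = min ((c : ℝ) * x) (c * y)
  rw [coe_inf, mul_min_of_nonneg _ _ c.2.1]

theorem IsPartiallyAdditive.map_odot {φ : A → unitInterval} (hφ : IsPartiallyAdditive φ) {x y : A}
    (h : odot x y = zero) : odot (φ x) (φ y) = zero := by
  rw [odot_eq_zero_iff, ← hφ x y h]
  exact (φ (x ⊕ₘ y)).2.2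

theorem IsPartiallyAdditive.map_oplus {φ : A → unitInterval} (hφ : IsPartiallyAdditive φ)
    {x y : A} (h : odot x y = zero) : φ (x ⊕ₘ y) = φ x ⊕ₘ φ y :=
  Subtype.ext (by rw [hφ x y h, coe_oplus_of_odot_eq_zero (hφ.map_odot h)])

/-- With one argument fixed, the map is a homomorphism scaled by a constant in [0,1]; scaling
preserves maxima, minima and sums that stay at most 1. -/
theorem mul_mem_bimorphisms {f : A → unitInterval} {g : B → unitInterval} (hf : IsHom f)
    (hg : IsHom g) : (fun x : A × B => f x.1 * g x.2) ∈ bimorphisms A B := by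
  have one_mul' : (one : unitInterval) * one = one :=
    Subtype.ext (by change ((one : unitInterval) : ℝ) * (one : unitInterval) = _; simp [coe_one])
  have mul_zero' : ∀ c : unitInterval, c * zero = zero := fun c => Subtype.ext (mul_zero (c : ℝ))
  have hr := fun a => isPartiallyAdditive_const_mul (f a) hg
  have hl := fun b => isPartiallyAdditive_const_mul (g b) hf
  simp only [mul_comm (g _)] at hl
  intro s t h
  have hL := Free.isHom_lift (fun x : A × B => f x.1 * g x.2)
  cases h with
  | one_one =>
    rw [hL.map_one]
    simp only [Free.lift_of, hf.map_one, hg.map_one, one_mul']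
  | right_zero a =>
    rw [hL.map_zero]
    simp only [Free.lift_of, hg.map_zero, mul_zero']
  | left_zero b =>
    rw [hL.map_zero]
    simp only [Free.lift_of, hf.map_zero, mul_comm zero, mul_zero']
  | right_sup a b b' =>
    rw [hL.map_sup]
    simp only [Free.lift_of, hg.map_sup, mul_sup_eq]
  | left_sup a a' b =>
    rw [hL.map_sup]
    simp only [Free.lift_of, hf.map_sup, mul_comm _ (g b), mul_sup_eq]
  | right_inf a b b' =>
    rw [hL.map_inf]
    simp only [Free.lift_of, hg.map_inf, mul_inf_eq]
  | left_inf a a' b =>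
    rw [hL.map_inf]
    simp only [Free.lift_of, hf.map_inf, mul_comm _ (g b), mul_inf_eq]
  | right_odot a b b' h =>
    rw [hL.map_odot, hL.map_zero]
    exact (hr a).map_odot h
  | left_odot a a' b h =>
    rw [hL.map_odot, hL.map_zero]
    exact (hl b).map_odot h
  | right_oplus a b b' h =>
    rw [hL.map_oplus]
    exact (hr a).map_oplus h
  | left_oplus a a' b h =>
    rw [hL.map_oplus]
    exact (hl b).map_oplus h

/-- Pairs of homomorphisms into `[0,1]` correspond to bimorphisms. -/
noncomputable def homeomorphBimorphisms (A : Type u) (B : Type v) [MVAlgebra A] [MVAlgebra B] :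
    cubeProd (W A) (W B) ≃ₜ bimorphisms A B where
  toFun p := ⟨_, mul_mem_bimorphisms p.2.1 p.2.2⟩
  -- The factors are recovered by setting the other argument to 1, where every homomorphism takes
  -- the value 1.
  invFun p := ⟨Sum.elim (fun a => (p : A × B → unitInterval) (a, one))
    (fun b => (p : A × B → unitInterval) (one, b)), isHom_left p.2, isHom_right p.2⟩
  left_inv := by
    rintro ⟨p, hf, hg⟩
    have hf1 : p (.inl one) = one := IsHom.map_one hf
    have hg1 : p (.inr one) = one := IsHom.map_one hg
    have h1 : (one : unitInterval) = 1 := Subtype.ext coe_one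
    refine Subtype.ext (funext fun x => ?_)
    rcases x with a | b
    · change p (.inl a) * p (.inr one) = p (.inl a)
      rw [hg1, h1, mul_one]
    · change p (.inl one) * p (.inr b) = p (.inr b)
      rw [hf1, h1, one_mul]
  right_inv p := Subtype.ext (funext fun x => (bimorphism_eq_mul p.2 x.1 x.2).symm)
  continuous_toFun := by
    refine Continuous.subtype_mk (continuous_pi fun x => ?_) _
    exact ((continuous_apply (Sum.inl x.1)).comp continuous_subtype_val).mul
      ((continuous_apply (Sum.inr x.2)).comp continuous_subtype_val)
  continuous_invFun := by
    refine Continuous.subtype_mk (continuous_pi fun x => ?_) _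
    rcases x with a | b
    · exact (continuous_apply (a, one)).comp continuous_subtype_val
    · exact (continuous_apply (one, b)).comp continuous_subtype_val

end Bimorphisms

end MVAlgebra

theorem mainTheorem6 {A : Type u} {B : Type v} [MVAlgebra A] [MVAlgebra B]
    (hA : MVAlgebra.IsSemisimple A) (hB : MVAlgebra.IsSemisimple B) :
    (MVAlgebra.ZHomeomorphic (MVAlgebra.W (MVAlgebra.Coprod A B))
        (MVAlgebra.cubeProd (MVAlgebra.W A) (MVAlgebra.W B)) ∧
      Nonempty (MVAlgebra.W (MVAlgebra.Coprod A B) ≃ₜ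
        MVAlgebra.W (MVAlgebra.SemisimpleTensor A B))) ∧
    (MVAlgebra.ZHomeomorphic
        (MVAlgebra.W (MVAlgebra.SemisimpleQuotient (MVAlgebra.Coprod A B)))
        (MVAlgebra.cubeProd (MVAlgebra.W A) (MVAlgebra.W B)) ∧
      Nonempty (MVAlgebra.W (MVAlgebra.SemisimpleQuotient (MVAlgebra.Coprod A B)) ≃ₜ
        MVAlgebra.W (MVAlgebra.SemisimpleTensor A B))) := by
  have hC := MVAlgebra.zHomeomorphic_generated (MVAlgebra.CoprodRel A B)
  have hS := MVAlgebra.zHomeomorphic_semisimpleQuotient_generated (MVAlgebra.CoprodRel A B)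
  rw [MVAlgebra.coprodRel_solutions] at hC hS
  obtain ⟨eT⟩ := (MVAlgebra.zHomeomorphic_semisimpleQuotient_generated
    (MVAlgebra.TensorRel A B)).nonempty_homeomorph
  obtain ⟨eC⟩ := hC.nonempty_homeomorph
  obtain ⟨eS⟩ := hS.nonempty_homeomorph
  -- The solutions of `TensorRel` are `bimorphisms A B` by definition, so `e` links W(A) × W(B) to
  -- the spectrum of the tensor product and serves both coproducts.
  have e := (MVAlgebra.homeomorphBimorphisms A B).trans eT.symm
  exact ⟨⟨hC, ⟨eC.trans e⟩⟩, hS, ⟨eS.trans e⟩⟩
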